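/- Let $b$ be a prime power, $\mathbb F_b$ the field with $b$ elements, $Z_b=\{0,\dots,b-1\}$, $s\ge 1$, and let $p_1,\dots,p_s\in\mathbb F_b[x]$ be pairwise coprime polynomials of degrees $e_i=\deg p_i\ge 1$. For $1\le i\le s$, $l\ge 1$, $0\le k<e_i$ let $y_{i,l,k}\in\mathbb F_b[x]$ be such that, for all $i$ and $l$, the residues of $y_{i,l,0},\dots,y_{i,l,e_i-1}$ modulo $p_i$ are linearly independent over $\mathbb F_b$. Let $a^{(i)}(l,k,r)$ be the coefficient of $x^{-r-1}$ $(r\ge0)$ in the expansion of $y_{i,l,k}/p_i^{\,l}$ in $\mathbb F_b((x^{-1}))$, and put $c^{(i)}_{j,r}=a^{(i)}(q+1,k,r)$ for $j\ge1$, $r\ge0$, where $j-1=qe_i+k$ with $q\ge 0$, $0\le k<e_i$. Let $\psi_r:Z_b\to\mathbb F_b$ $(r\ge 0)$ and $\eta_{i,j}:\mathbb F_b\to Z_b$ $(1\le i\le s,\ j\ge1)$ be bijections with $\psi_r(0)=0$ for all sufficiently large $r$. For $n=\sum_{r\ge0}a_r(n)b^r$ with $a_r(n)\in Z_b$ put $$x_n^{(i)}=\sum_{j\ge1}x^{(i)}_{n,j}b^{-j},\qquad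 x^{(i)}_{n,j}=\eta_{i,j}\Big(\sum_{r\ge0}c^{(i)}_{j,r}\,\psi_r(a_r(n))\Big),\qquad \mathbf x_n=(x_n^{(1)},\dots,x_n^{(s)}),$$ and assume that no digit sequence $(x^{(i)}_{n,j})_{j\ge1}$ is eventually equal to $b-1$, so that $\mathbf x_n\in[0,1)^s$ and these are the $b$-adic digits of $x^{(i)}_n$. Such a sequence $(\mathbf x_n)_{n\ge0}$ is called a generalized Niederreiter sequence with generating polynomials $p_1,\dots,p_s$. Let $\oplus$ denote digitwise addition modulo $b$ of base $b$ expansions, for the $m$ base $b$ digits of integers in $[0,b^m)$ and, coordinatewise, for the $b$-adic digits of points of $[0,1)^s$. Let $E_m$ be the set of truncations $[y]_m=\sum_{j=1}^m y_jb^{-j}$ of the numbers $y=\sum_{j\ge1}y_jb^{-j}\in[0,1)$. For points $\mathbf z_0,\dots,\mathbf z_{N-1}$ of $[0,1)^s$ let $$D^*((\mathbf z_n)_{0\le n<N})=\sup_{0<\gamma_1,\dots,\gamma_s\le1}\Big|\tfrac1N\#\{0\le n<N:\ \mathbf z_n\in[0,\gamma_1)\times\dots\times[0,\gamma_s)\}-\gamma_1\cdots\gamma_s\Big|.$$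 Set $e_0=e_1+\dots+e_s$, $d=e_0$, $t=e_0-s$ and $K=4(d+t)s^2$. Then for every integer $m\ge 9(d+t)s^2$ $$1+\min_{0\le Q<b^m}\ \max_{1\le N\le b^m,\ \mathbf w\in E_m^s} N\,D^*\big((\mathbf x_{n\oplus Q}\oplus\mathbf w)_{0\le n<N}\big)\ \ge\ b^{-d}K^{-s}m^s .$$ -/

import Mathlib

open Polynomial Finset

noncomputable section

/-- The `r`-th digit (`r = 0, 1, …`, least significant first) of `n` in base `b`. -/
def natDigit (b : ℕ) [NeZero b] (n r : ℕ) : Fin b := Fin.ofNat b (n / b ^ r)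

/-- `n ⊕ q` for `n, q ∈ [0, b ^ m)`: digitwise addition modulo `b` of the `m` digits
(addition in `Fin b` is addition modulo `b`). -/
def natDigitAdd (b : ℕ) [NeZero b] (m n q : ℕ) : ℕ :=
  ∑ r ∈ range m, ((natDigit b n r + natDigit b q r : Fin b) : ℕ) * b ^ r

/-- The truncation `[x]_m = ∑_{1 ≤ j ≤ m} x_j b^{-j}` of `x = ∑_{j ≥ 1} x_j b^{-j} ∈ [0,1)`;
the digit `x_j` is `Real.digits x b (j - 1)`. -/
def digitTrunc (b : ℕ) [NeZero b] (m : ℕ) (x : ℝ) : ℝ :=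
  ∑ j ∈ range m, ((Real.digits x b j : ℕ) : ℝ) * ((b : ℝ) ^ (j + 1))⁻¹

/-- `E_m = {[y]_m : y ∈ [0,1)}`. -/
def digitGrid (b : ℕ) [NeZero b] (m : ℕ) : Set ℝ :=
  {v | ∃ y : ℝ, 0 ≤ y ∧ y < 1 ∧ v = digitTrunc b m y}

/-- The `b`-adic digital shift `x ⊕ w`, coordinate by coordinate. -/
def digitalShift (b : ℕ) [NeZero b] {s : ℕ} (x w : Fin s → ℝ) : Fin s → ℝ :=
  fun i => Real.ofDigits (fun j => Real.digits (x i) b j + Real.digits (w i) b j)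

open Classical in
/-- `Δ((x_n)_{0 ≤ n < N}, J_γ)`, where `J_γ = ∏ [0, γ_i)`. -/
def localDiscrepancy {s : ℕ} (x : ℕ → Fin s → ℝ) (N : ℕ) (γ : Fin s → ℝ) : ℝ :=
  (((range N).filter (fun n => ∀ i, x n i ∈ Set.Ico 0 (γ i))).card : ℝ) - N * ∏ i, γ i

/-- The star discrepancy `D*` of the points `x_0, …, x_{N-1}` (for `N ≥ 1`). -/
def starDiscrepancy {s : ℕ} (x : ℕ → Fin s → ℝ) (N : ℕ) : ℝ :=
  sSup {v | ∃ γ : Fin s → ℝ, (∀ i, 0 < γ i ∧ γ i ≤ 1) ∧ v = |localDiscrepancy x N γ| / N}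

/-- `K_{d,t,s} = 4 (d + t) (s - 1) ^ 2`. -/
def boundK (d t s : ℕ) : ℝ := 4 * ((d : ℝ) + t) * ((s : ℝ) - 1) ^ 2

/-- The field of formal Laurent series in `x⁻¹` is `LaurentSeries F`, its variable being `x⁻¹`;
this is the embedding `F[x] → F((x⁻¹))`, which sends `x` to the inverse of that variable. -/
def polyAtInfinity {F : Type*} [Field F] (f : F[X]) : LaurentSeries F :=
  Polynomial.aeval (HahnSeries.single (-1 : ℤ) (1 : F) : LaurentSeries F) f

/-- The coefficient of `x^{-r-1}` in the expansion of `y / p ^ j` in `F((x⁻¹))`. -/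
def expansionCoeff {F : Type*} [Field F] (y p : F[X]) (j r : ℕ) : F :=
  HahnSeries.coeff (polyAtInfinity y / polyAtInfinity p ^ j) ((r : ℤ) + 1)

/-- Entry in row `j + 1` and column `r` (`j, r = 0, 1, …`) of the generating matrix that belongs
to the polynomial `p` and the numerators `y l k` (`l ≥ 1`, `0 ≤ k < deg p`): with
`j = Q * deg p + k`, `0 ≤ k < deg p`, it is the coefficient of `x^{-r-1}` in
`y (Q + 1) k / p ^ (Q + 1)`. -/
def niederreiterEntry {F : Type*} [Field F] (p : F[X]) (y : ℕ → ℕ → F[X]) (j r : ℕ) : F :=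
  expansionCoeff (y (j / p.natDegree + 1) (j % p.natDegree)) p (j / p.natDegree + 1) r

/-- The digits (index `j` is the digit of `b^{-j-1}`) of one coordinate of the `n`-th point of the
digital sequence with generating matrix `C`, with the bijections `ψ r` on the digits of `n` and
`η j` on the digits of the point. The sum is finite when `ψ r 0 = 0` for all large `r`. -/
def digitalDigit {F : Type*} [Field F] (b : ℕ) [NeZero b] (ψ : ℕ → Fin b ≃ F)
    (η : ℕ → F ≃ Fin b) (C : ℕ → ℕ → F) (n j : ℕ) : Fin b :=
  η j (∑ᶠ r : ℕ, C j r * ψ r (natDigit b n r))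

/-- `x` is a generalized Niederreiter sequence over the field `F` with `b` elements, with
generating polynomials `p i`: these are nonconstant and pairwise coprime, and `x` is the digital
sequence of the matrices built from numerators `y i l k` such that, for all `i` and `l ≥ 1`, the
residues of `y i l k`, `0 ≤ k < deg (p i)`, modulo `p i` are linearly independent over `F`.
As the points lie in `[0,1)^s` and are given by their base `b` expansions, no digit sequence may
end in a string of digits `b - 1`. -/
def IsGeneralizedNiederreiter {F : Type*} [Field F] (b : ℕ) [NeZero b] {s : ℕ}
    (p : Fin s → F[X]) (x : ℕ → Fin s → ℝ) : Prop :=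
  (∀ i, 1 ≤ (p i).natDegree) ∧
  (∀ i i', i ≠ i' → IsCoprime (p i) (p i')) ∧
  ∃ (y : Fin s → ℕ → ℕ → F[X]) (ψ : ℕ → Fin b ≃ F) (η : Fin s → ℕ → F ≃ Fin b),
    (∀ i l, 1 ≤ l →
      LinearIndependent F (fun k : Fin (p i).natDegree => y i l (k : ℕ) % p i)) ∧
    (∃ R, ∀ r, R ≤ r → ψ r 0 = 0) ∧
    (∀ n i J, ∃ j, J ≤ j ∧
      ((digitalDigit b ψ (η i) (niederreiterEntry (p i) (y i)) n j : Fin b) : ℕ) + 1 ≠ b) ∧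
    ∀ n i, x n i =
      Real.ofDigits (digitalDigit b ψ (η i) (niederreiterEntry (p i) (y i)) n)

end

noncomputable section

/-! ### The embedding of `F[x]` into `F((x⁻¹))` -/

/-! Appending the coordinate `n / b ^ m` to the points `x_{n ⊕ Q} ⊕ w` gives a net of `b ^ m` points
in dimension `s + 1`. If block lengths `q_o * e_o`, with `e = 1` for the new coordinate, total at
least `m`, then these leading digits determine the point (`eq_of_netDigits_eq`). The reason is
algebraic: two points that agree in them yield a polynomial divisible by `∏ p_i ^ q_i` but of
smaller degree, hence zero (`eq_zero_of_niederreiter_rows`).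

Split a test box `∏ [0, γ_o)` according to the first position `j_o` at which the digits of a point
fall below those of `γ_o`. A piece with `∑ (j_o + 1) ≤ m - t` contains exactly the expected number
of points (`boxDefect_eq_zero`). If a point of the net has the first `m` digits of `γ`, a piece with
`∑ j_o ≥ m + t` is empty, since any point in it would coincide with that one
(`boxIndices_eq_empty`). Put `G = d + t + 1` and give `γ` nonzero digits only at positions in
suitable residue classes modulo `G`. Then `∑ (j_o + 1) ≡ m + d + 1` modulo `G`, so no nonempty piece
lies between the two ranges and all errors have the same sign (`sum_add_le_or_le_sum`,
`le_volume_sub_card`).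

Taking those digits to be `b - 1`, at least `⌊m / (G s)⌋ ^ s` empty pieces have `∑ (j_o + 1) = m + d
+ 1` (`exists_critical_positions`), and each contributes `(b - 1) ^ (s + 1) / b ^ (d + 1)` to the
deficit. The last side length of the box is `N / b ^ m`, so the deficit is one of the first `N`
points; the shift `w` serves to move the point of index `N` to the corner. -/

theorem polyAtInfinity_mul {F : Type*} [Field F] (f g : F[X]) :
    polyAtInfinity (f * g) = polyAtInfinity f * polyAtInfinity g := map_mul _ f g

theorem polyAtInfinity_add {F : Type*} [Field F] (f g : F[X]) :
    polyAtInfinity (f + g) = polyAtInfinity f + polyAtInfinity g := map_add _ f g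

theorem polyAtInfinity_pow {F : Type*} [Field F] (f : F[X]) (n : ℕ) :
    polyAtInfinity (f ^ n) = polyAtInfinity f ^ n := map_pow _ f n

theorem polyAtInfinity_sum {F : Type*} [Field F] {ι : Type*} (S : Finset ι) (f : ι → F[X]) :
    polyAtInfinity (∑ i ∈ S, f i) = ∑ i ∈ S, polyAtInfinity (f i) := map_sum _ f S

theorem polyAtInfinity_monomial {F : Type*} [Field F] (n : ℕ) (c : F) :
    polyAtInfinity (monomial n c) = HahnSeries.single (-(n : ℤ)) c := by
  have h : algebraMap F (LaurentSeries F) c = HahnSeries.C c := LaurentSeries.algebraMap_apply F c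
  rw [polyAtInfinity, aeval_monomial, HahnSeries.single_pow]
  refine (congrArg (· * _) h).trans ?_
  simp [HahnSeries.C_apply]

theorem coeff_polyAtInfinity {F : Type*} [Field F] (f : F[X]) (z : ℤ) :
    (polyAtInfinity f).coeff z = if 0 < z then 0 else f.coeff (-z).toNat := by
  induction f using Polynomial.induction_on' with
  | add f g hf hg =>
    rw [polyAtInfinity_add, HahnSeries.coeff_add, hf, hg]
    split_ifs <;> simp
  | monomial n c =>
    rw [polyAtInfinity_monomial, HahnSeries.coeff_single, coeff_monomial]
    split_ifs <;> first | rfl | omega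

theorem polyAtInfinity_ne_zero {F : Type*} [Field F] {f : F[X]} (hf : f ≠ 0) :
    polyAtInfinity f ≠ 0 := by
  intro h
  apply hf
  ext n
  have := coeff_polyAtInfinity f (-(n : ℤ))
  rw [h, if_neg (by omega)] at this
  simpa using this.symm

theorem order_polyAtInfinity {F : Type*} [Field F] {f : F[X]} (hf : f ≠ 0) :
    (polyAtInfinity f).order = -(f.natDegree : ℤ) := by
  apply le_antisymm
  · apply HahnSeries.order_le_of_coeff_ne_zero
    rw [coeff_polyAtInfinity, if_neg (by omega)]
    simpa using hf
  · by_contra! h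
    have h0 : (polyAtInfinity f).coeff (polyAtInfinity f).order ≠ 0 := by
      rw [Ne, HahnSeries.coeff_order_eq_zero]
      exact polyAtInfinity_ne_zero hf
    apply h0
    rw [coeff_polyAtInfinity, if_neg (by omega)]
    apply coeff_eq_zero_of_natDegree_lt
    omega

/-- If `deg f + 1 = deg p`, then `f / p` has a nonzero coefficient of `x⁻¹`. -/
theorem coeff_one_div_ne_zero {F : Type*} [Field F] {f p : F[X]} (hf : f ≠ 0) (hp : p ≠ 0)
    (h : f.natDegree + 1 = p.natDegree) :
    (polyAtInfinity f / polyAtInfinity p).coeff 1 ≠ 0 := by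
  have hA : polyAtInfinity f / polyAtInfinity p ≠ 0 :=
    div_ne_zero (polyAtInfinity_ne_zero hf) (polyAtInfinity_ne_zero hp)
  have hmul := div_mul_cancel₀ (polyAtInfinity f) (polyAtInfinity_ne_zero hp)
  have hord := HahnSeries.order_mul hA (polyAtInfinity_ne_zero hp)
  rw [hmul, order_polyAtInfinity hf, order_polyAtInfinity hp] at hord
  have h1 : (polyAtInfinity f / polyAtInfinity p).order = 1 := by omega
  rw [← h1, Ne, HahnSeries.coeff_order_eq_zero]
  exact hA

/-- The functional `u ↦` coefficient of `x⁻¹` in `u * g / p`. -/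
def residueFunctional {F : Type*} [Field F] (g p : F[X]) : F[X] →ₗ[F] F where
  toFun u := (polyAtInfinity (u * g) / polyAtInfinity p).coeff 1
  map_add' u v := by
    rw [add_mul, polyAtInfinity_add, add_div, HahnSeries.coeff_add]
  map_smul' c u := by
    rw [smul_mul_assoc, smul_eq_C_mul, ← monomial_zero_left, polyAtInfinity_mul,
      polyAtInfinity_monomial, mul_div_assoc, RingHom.id_apply, smul_eq_mul,
      ← HahnSeries.coeff_single_mul_add (b := 0)]
    simp

theorem residueFunctional_apply {F : Type*} [Field F] (g p u : F[X]) :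
    residueFunctional g p u = (polyAtInfinity (u * g) / polyAtInfinity p).coeff 1 := rfl

theorem residueFunctional_eq_zero_of_dvd {F : Type*} [Field F] {g p u : F[X]} (hp : p ≠ 0)
    (h : p ∣ u * g) : residueFunctional g p u = 0 := by
  obtain ⟨v, hv⟩ := h
  rw [residueFunctional_apply, hv, polyAtInfinity_mul,
    mul_div_cancel_left₀ _ (polyAtInfinity_ne_zero hp), coeff_polyAtInfinity, if_pos one_pos]

theorem residueFunctional_mod {F : Type*} [Field F] {g p : F[X]} (hp : p ≠ 0) (u : F[X]) :
    residueFunctional g p (u % p) = residueFunctional g p u := by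
  conv_rhs => rw [← EuclideanDomain.mod_add_div u p]
  rw [map_add, residueFunctional_eq_zero_of_dvd (u := p * (u / p)) hp
    ((dvd_mul_right _ _).mul_right _), add_zero]

/-- Linearly independent residues modulo `p` span all polynomials of degree below `deg p`. -/
theorem span_mod_eq_degreeLT {F : Type*} [Field F] {p : F[X]} (hp : p ≠ 0)
    (y : Fin p.natDegree → F[X]) (hy : LinearIndependent F fun k => y k % p) :
    Submodule.span F (Set.range fun k => y k % p) = degreeLT F p.natDegree := by
  have hfd : FiniteDimensional F (degreeLT F p.natDegree) :=
    Module.Finite.equiv (degreeLTEquiv F p.natDegree).symm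
  refine Submodule.eq_of_le_of_finrank_eq ?_ ?_
  · rw [Submodule.span_le]
    rintro _ ⟨k, rfl⟩
    rw [SetLike.mem_coe, mem_degreeLT, ← degree_eq_natDegree hp]
    exact EuclideanDomain.mod_lt _ hp
  · rw [finrank_span_eq_card hy, (degreeLTEquiv F p.natDegree).finrank_eq]
    simp

/-- The residue pairing modulo `p` is nondegenerate. The functional depends on `u` modulo `p` only,
so it vanishes on all polynomials of degree below `deg p`; a nonzero remainder `r` of `g` is
detected by the power of `X` that lifts `r` to degree `deg p - 1`. -/
theorem dvd_of_residues_eq_zero {F : Type*} [Field F] {p g : F[X]} (hp : 1 ≤ p.natDegree)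
    (y : Fin p.natDegree → F[X]) (hy : LinearIndependent F fun k => y k % p)
    (h : ∀ k, (polyAtInfinity (y k * g) / polyAtInfinity p).coeff 1 = 0) : p ∣ g := by
  have hp0 : p ≠ 0 := by
    rintro rfl
    simp at hp
  have hker : degreeLT F p.natDegree ≤ LinearMap.ker (residueFunctional g p) := by
    rw [← span_mod_eq_degreeLT hp0 y hy, Submodule.span_le]
    rintro _ ⟨k, rfl⟩
    rw [SetLike.mem_coe, LinearMap.mem_ker, residueFunctional_mod hp0]
    exact h k
  by_contra hdvd
  set r := g % p with hr
  have hr0 : r ≠ 0 := fun h0 => hdvd (EuclideanDomain.mod_eq_zero.1 h0)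
  have hrdeg : r.natDegree < p.natDegree :=
    natDegree_lt_natDegree hr0 (EuclideanDomain.mod_lt _ hp0)
  set u : F[X] := X ^ (p.natDegree - 1 - r.natDegree) with hu
  have hu0 : residueFunctional g p u = 0 := by
    refine hker ?_
    rw [mem_degreeLT, hu, degree_X_pow]
    exact_mod_cast by omega
  refine coeff_one_div_ne_zero (f := u * r) (mul_ne_zero (pow_ne_zero _ X_ne_zero) hr0) hp0 ?_ ?_
  · rw [natDegree_mul (pow_ne_zero _ X_ne_zero) hr0, natDegree_X_pow]
    omega
  · have h1 : residueFunctional (r + p * (g / p)) p u = 0 := by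
      rw [hr, EuclideanDomain.mod_add_div]
      exact hu0
    rw [residueFunctional_apply, mul_add, polyAtInfinity_add, add_div, HahnSeries.coeff_add] at h1
    have h2 := residueFunctional_eq_zero_of_dvd (g := p * (g / p)) (u := u) hp0
      ((dvd_mul_right _ _).mul_left _)
    rw [residueFunctional_apply] at h2
    rwa [h2, add_zero] at h1

/-- Once `f = p ^ q * g`, the quotient `y f / p ^ (q + 1)` equals `y g / p`, so the next block of
conditions says that `p` divides `g`. -/
theorem pow_dvd_of_residues_eq_zero {F : Type*} [Field F] {p : F[X]} (hp : 1 ≤ p.natDegree)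
    (y : ℕ → ℕ → F[X])
    (hy : ∀ l, 1 ≤ l → LinearIndependent F fun k : Fin p.natDegree => y l (k : ℕ) % p)
    (f : F[X]) (q : ℕ)
    (h : ∀ l < q, ∀ k < p.natDegree,
      (polyAtInfinity (y (l + 1) k) / polyAtInfinity p ^ (l + 1) * polyAtInfinity f).coeff 1 = 0) :
    p ^ q ∣ f := by
  have hp0 : p ≠ 0 := by
    rintro rfl
    simp at hp
  induction q with
  | zero => simp
  | succ q ih =>
    obtain ⟨g, rfl⟩ := ih fun l hl => h l (by omega)
    rw [pow_succ]
    refine mul_dvd_mul_left _ (dvd_of_residues_eq_zero hp _ (hy (q + 1) (by omega)) fun k => ?_)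
    rw [← h q (by omega) k k.2]
    congr 1
    have := polyAtInfinity_ne_zero hp0
    rw [polyAtInfinity_mul, polyAtInfinity_mul, polyAtInfinity_pow]
    field_simp
    ring

/-- Multiplication by `x ^ r` moves the coefficient of `x^{-r-1}` to `x^{-1}`, so a row times a
vector becomes a residue. -/
theorem sum_expansionCoeff_mul {F : Type*} [Field F] (y p : F[X]) (l h : ℕ) (f : ℕ → F) :
    ∑ r ∈ range h, expansionCoeff y p l r * f r =
      (polyAtInfinity y / polyAtInfinity p ^ l *
        polyAtInfinity (∑ r ∈ range h, monomial r (f r))).coeff 1 := by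
  rw [polyAtInfinity_sum, mul_sum, HahnSeries.coeff_sum]
  refine sum_congr rfl fun r _ => ?_
  rw [polyAtInfinity_monomial, expansionCoeff, ← HahnSeries.coeff_mul_single_add]
  congr 1
  ring

/-- A vector that is annihilated by the first `q i * deg (p i)` rows of the `i`-th Niederreiter
matrix, for all `i`, and has at most `∑ q i * deg (p i)` entries, is zero. -/
theorem eq_zero_of_niederreiter_rows {F : Type*} [Field F] {s : ℕ} {p : Fin s → F[X]}
    (hp : ∀ i, 1 ≤ (p i).natDegree) (hcop : ∀ i i', i ≠ i' → IsCoprime (p i) (p i'))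
    {y : Fin s → ℕ → ℕ → F[X]}
    (hy : ∀ i l, 1 ≤ l →
      LinearIndependent F (fun k : Fin (p i).natDegree => y i l (k : ℕ) % p i))
    (q : Fin s → ℕ) (h : ℕ) (hh : h ≤ ∑ i, q i * (p i).natDegree) (f : ℕ → F)
    (hf : ∀ i, ∀ j < q i * (p i).natDegree,
      ∑ r ∈ range h, niederreiterEntry (p i) (y i) j r * f r = 0) :
    ∀ r < h, f r = 0 := by
  set g : F[X] := ∑ r ∈ range h, monomial r (f r) with hg
  have hcoeff : ∀ r < h, g.coeff r = f r := by
    intro r hr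
    simp [hg, finsetSum_coeff, coeff_monomial, hr]
  have hhigh : ∀ n, h ≤ n → g.coeff n = 0 := by
    intro n hn
    rw [hg, finsetSum_coeff]
    refine sum_eq_zero fun r hr => ?_
    rw [coeff_monomial, if_neg]
    have := mem_range.1 hr
    omega
  have hp0 : ∀ i, p i ≠ 0 := by
    intro i h0
    have := hp i
    simp [h0] at this
  have hdvd : ∏ i, p i ^ q i ∣ g := by
    refine prod_dvd_of_coprime (fun i _ i' _ hii => (hcop i i' hii).pow) fun i _ => ?_
    refine pow_dvd_of_residues_eq_zero (hp i) (y i) (hy i) g (q i) fun l hl k hk => ?_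
    have hj : l * (p i).natDegree + k < q i * (p i).natDegree :=
      calc l * (p i).natDegree + k < (l + 1) * (p i).natDegree := by rw [add_mul]; omega
        _ ≤ _ := Nat.mul_le_mul_right _ hl
    have := hf i _ hj
    rw [hg, ← sum_expansionCoeff_mul, ← this]
    refine sum_congr rfl fun r _ => ?_
    have h1 : (l * (p i).natDegree + k) / (p i).natDegree = l := by
      rw [mul_comm, Nat.mul_add_div (hp i), Nat.div_eq_of_lt hk, add_zero]
    have h2 : (l * (p i).natDegree + k) % (p i).natDegree = k := by
      rw [mul_comm, Nat.mul_add_mod, Nat.mod_eq_of_lt hk]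
    rw [niederreiterEntry, h1, h2]
  -- The divisor has degree `∑ q i * deg (p i) ≥ h`, while the coefficients of `g` vanish from index
  -- `h` on.
  have hg0 : g = 0 := by
    by_contra hne
    have hdeg := natDegree_le_of_dvd hdvd hne
    rw [natDegree_prod _ _ fun i _ => pow_ne_zero _ (hp0 i)] at hdeg
    simp only [natDegree_pow] at hdeg
    have hc : g.coeff g.natDegree ≠ 0 := by simpa using hne
    exact hc (hhigh _ (hh.trans hdeg))
  intro r hr
  rw [← hcoeff r hr, hg0, coeff_zero]

/-! ### Digit strings and their values -/

/-- The integer with the base `b` digits `u 0, …, u (m - 1)`, most significant first. -/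
def digitVal {b : ℕ} (u : ℕ → Fin b) : ℕ → ℕ
  | 0 => 0
  | m + 1 => b * digitVal u m + u m

theorem digitVal_congr {b : ℕ} {u v : ℕ → Fin b} {m : ℕ} (h : ∀ j < m, u j = v j) :
    digitVal u m = digitVal v m := by
  induction m with
  | zero => rfl
  | succ m ih => rw [digitVal, digitVal, ih fun j hj => h j (by omega), h m (by omega)]

theorem mul_add_lt_mul_add_iff {b a c x y : ℕ} (hx : x < b) (hy : y < b) :
    b * a + x < b * c + y ↔ a < c ∨ a = c ∧ x < y := by
  rcases lt_trichotomy a c with h | rfl | h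
  · have : b * (a + 1) ≤ b * c := Nat.mul_le_mul_left _ h
    rw [mul_add] at this
    simp only [h, true_or, iff_true]
    omega
  · simp
  · have : b * (c + 1) ≤ b * a := Nat.mul_le_mul_left _ h
    rw [mul_add] at this
    constructor <;> intro h' <;> omega

theorem mul_add_eq_mul_add_iff {b a c x y : ℕ} (hx : x < b) (hy : y < b) :
    b * a + x = b * c + y ↔ a = c ∧ x = y := by
  have h1 := mul_add_lt_mul_add_iff (a := a) (c := c) hx hy
  have h2 := mul_add_lt_mul_add_iff (a := c) (c := a) hy hx
  omega

theorem digitVal_eq_iff {b : ℕ} {u v : ℕ → Fin b} {m : ℕ} :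
    digitVal u m = digitVal v m ↔ ∀ j < m, u j = v j := by
  induction m with
  | zero => simp [digitVal]
  | succ m ih =>
    rw [digitVal, digitVal, mul_add_eq_mul_add_iff (u m).2 (v m).2, ih, Fin.val_inj]
    constructor
    · rintro ⟨h1, h2⟩ j hj
      rcases Nat.lt_succ_iff_lt_or_eq.1 hj with h | rfl
      exacts [h1 j h, h2]
    · exact fun h => ⟨fun j hj => h j (by omega), h m (by omega)⟩

/-- The order is lexicographic; the first differing position `j` will index the pieces of a test
box. -/
theorem digitVal_lt_iff {b : ℕ} {u v : ℕ → Fin b} {m : ℕ} :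
    digitVal u m < digitVal v m ↔ ∃ j < m, (∀ k < j, u k = v k) ∧ u j < v j := by
  induction m with
  | zero => simp [digitVal]
  | succ m ih =>
    rw [digitVal, digitVal, mul_add_lt_mul_add_iff (u m).2 (v m).2, ih, digitVal_eq_iff]
    constructor
    · rintro (⟨j, hj, h⟩ | ⟨h1, h2⟩)
      exacts [⟨j, by omega, h⟩, ⟨m, by omega, h1, h2⟩]
    · rintro ⟨j, hj, h⟩
      rcases Nat.lt_succ_iff_lt_or_eq.1 hj with h' | rfl
      exacts [Or.inl ⟨j, h', h⟩, Or.inr h]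

theorem digitVal_lt_pow {b : ℕ} (u : ℕ → Fin b) (m : ℕ) : digitVal u m < b ^ m := by
  induction m with
  | zero => simp [digitVal]
  | succ m ih =>
    have : b * (digitVal u m + 1) ≤ b * b ^ m := Nat.mul_le_mul_left _ ih
    rw [digitVal, pow_succ']
    have := (u m).2
    rw [mul_add] at *
    omega

theorem digitVal_eq_sum {b : ℕ} (u : ℕ → Fin b) (m : ℕ) :
    digitVal u m = ∑ j ∈ range m, (u j : ℕ) * b ^ (m - 1 - j) := by
  induction m with
  | zero => rfl
  | succ m ih =>
    rw [digitVal, ih, sum_range_succ, mul_sum]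
    simp only [add_tsub_cancel_right, tsub_self, pow_zero, mul_one, add_left_inj]
    refine sum_congr rfl fun j hj => ?_
    have := mem_range.1 hj
    rw [show m - j = (m - 1 - j) + 1 by omega, pow_succ]
    ring

theorem natDigit_succ (b : ℕ) [NeZero b] (n r : ℕ) :
    natDigit b n (r + 1) = natDigit b (n / b) r := by
  rw [natDigit, natDigit, pow_succ', Nat.div_div_eq_div_mul]

theorem digitVal_natDigit {b : ℕ} [NeZero b] {n m : ℕ} (hn : n < b ^ m) :
    digitVal (fun j => natDigit b n (m - 1 - j)) m = n := by
  induction m generalizing n with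
  | zero => simp at hn; simp [digitVal, hn]
  | succ m ih =>
    have h : n / b < b ^ m := Nat.div_lt_of_lt_mul (by rwa [← pow_succ'])
    rw [digitVal, digitVal_congr (v := fun j => natDigit b (n / b) (m - 1 - j)), ih h]
    · simp only [add_tsub_cancel_right, tsub_self, natDigit, pow_zero, Nat.div_one, Fin.val_ofNat]
      exact Nat.div_add_mod n b
    · intro j hj
      rw [← natDigit_succ]
      congr 1
      omega

theorem natDigit_eq_zero {b : ℕ} [NeZero b] {n r : ℕ} (h : n < b ^ r) : natDigit b n r = 0 := by
  rw [natDigit, Nat.div_eq_of_lt h]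
  rfl

theorem natDigit_eq_zero_of_le {b : ℕ} [NeZero b] {n m r : ℕ} (h : n < b ^ m) (hr : m ≤ r) :
    natDigit b n r = 0 :=
  natDigit_eq_zero (h.trans_le (Nat.pow_le_pow_right (NeZero.pos b) hr))

theorem natDigit_digitVal {b : ℕ} [NeZero b] (u : ℕ → Fin b) {m j : ℕ} (hj : j < m) :
    natDigit b (digitVal u m) (m - 1 - j) = u j :=
  digitVal_eq_iff.1 (digitVal_natDigit (digitVal_lt_pow u m)) j hj

theorem natDigitAdd_eq_digitVal (b : ℕ) [NeZero b] (m n q : ℕ) :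
    natDigitAdd b m n q =
      digitVal (fun j => natDigit b n (m - 1 - j) + natDigit b q (m - 1 - j)) m := by
  rw [digitVal_eq_sum, natDigitAdd, ← sum_range_reflect]

theorem natDigitAdd_lt (b : ℕ) [NeZero b] (m n q : ℕ) : natDigitAdd b m n q < b ^ m := by
  rw [natDigitAdd_eq_digitVal]
  exact digitVal_lt_pow _ _

theorem natDigit_natDigitAdd (b : ℕ) [NeZero b] {m r : ℕ} (n q : ℕ) (hr : r < m) :
    natDigit b (natDigitAdd b m n q) r = natDigit b n r + natDigit b q r := by
  have h := natDigit_digitVal (fun j => natDigit b n (m - 1 - j) + natDigit b q (m - 1 - j))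
    (m := m) (j := m - 1 - r) (by omega)
  rw [← natDigitAdd_eq_digitVal] at h
  simpa only [show m - 1 - (m - 1 - r) = r by omega] using h

theorem eq_of_natDigit_eq {b : ℕ} [NeZero b] {n n' m : ℕ} (hn : n < b ^ m) (hn' : n' < b ^ m)
    (h : ∀ r < m, natDigit b n r = natDigit b n' r) : n = n' := by
  rw [← digitVal_natDigit hn, ← digitVal_natDigit hn']
  exact digitVal_congr fun j hj => h _ (by omega)

/-! ### Real numbers with given digits -/

theorem pow_mul_ofDigits {b : ℕ} [NeZero b] (u : ℕ → Fin b) (m : ℕ) :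
    (b : ℝ) ^ m * Real.ofDigits u = digitVal u m + Real.ofDigits (fun j => u (j + m)) := by
  have hb : (b : ℝ) ≠ 0 := NeZero.ne _
  induction m with
  | zero => simp [digitVal]
  | succ m ih =>
    rw [pow_succ', mul_assoc, ih, Real.ofDigits_eq_sum_add_ofDigits (fun j => u (j + m)) 1]
    simp only [sum_range_one, Real.ofDigitsTerm, digitVal, Nat.cast_add, Nat.cast_mul, zero_add,
      pow_one, add_assoc, add_comm 1 m]
    field_simp

theorem ofDigits_lt_one {b : ℕ} [NeZero b] {u : ℕ → Fin b} {j : ℕ} (hj : (u j : ℕ) + 1 ≠ b) :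
    Real.ofDigits u < 1 := by
  have hb : (0 : ℝ) < (b : ℝ) ^ (j + 1) := pow_pos (Nat.cast_pos.2 (NeZero.pos b)) _
  have h1 := pow_mul_ofDigits u (j + 1)
  have h2 := Real.ofDigits_le_one (fun k => u (k + (j + 1)))
  have h3 : digitVal u (j + 1) + 1 < b ^ (j + 1) := by
    have h4 : b * (digitVal u j + 1) ≤ b * b ^ j := Nat.mul_le_mul_left _ (digitVal_lt_pow u j)
    have := (u j).2
    rw [digitVal, pow_succ']
    rw [mul_add] at h4
    omega
  have h5 : (digitVal u (j + 1) : ℝ) + 1 < (b : ℝ) ^ (j + 1) := by exact_mod_cast h3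
  by_contra! h
  nlinarith

/-- Every tail has a digit other than `b - 1`, hence value below `1`, so the floor in `Real.digits`
cuts exactly at the tail. -/
theorem digits_ofDigits {b : ℕ} [NeZero b] {u : ℕ → Fin b}
    (hu : ∀ J, ∃ j, J ≤ j ∧ (u j : ℕ) + 1 ≠ b) : Real.digits (Real.ofDigits u) b = u := by
  funext j
  obtain ⟨k, hk, hk'⟩ := hu (j + 1)
  have hlt : Real.ofDigits (fun i => u (i + (j + 1))) < 1 :=
    ofDigits_lt_one (j := k - (j + 1)) (by rwa [show k - (j + 1) + (j + 1) = k by omega])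
  have hfloor : ⌊Real.ofDigits u * b ^ (j + 1)⌋₊ = digitVal u (j + 1) := by
    rw [mul_comm, pow_mul_ofDigits, Nat.floor_eq_iff (by
      have := Real.ofDigits_nonneg (fun i => u (i + (j + 1)))
      positivity)]
    have := Real.ofDigits_nonneg (fun i => u (i + (j + 1)))
    constructor <;> linarith
  rw [Real.digits, hfloor, digitVal]
  apply Fin.ext
  rw [Fin.val_ofNat, Nat.mul_add_mod, Nat.mod_eq_of_lt (u j).2]

theorem ofDigits_lt_div_iff {b : ℕ} [NeZero b] {u : ℕ → Fin b}
    (hu : ∀ J, ∃ j, J ≤ j ∧ (u j : ℕ) + 1 ≠ b) (m G : ℕ) :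
    Real.ofDigits u < (G : ℝ) / (b : ℝ) ^ m ↔ digitVal u m < G := by
  have hb : (0 : ℝ) < (b : ℝ) ^ m := pow_pos (Nat.cast_pos.2 (NeZero.pos b)) _
  obtain ⟨k, hk, hk'⟩ := hu m
  have hlt : Real.ofDigits (fun i => u (i + m)) < 1 :=
    ofDigits_lt_one (j := k - m) (by rwa [show k - m + m = k by omega])
  have hnn := Real.ofDigits_nonneg (fun i => u (i + m))
  rw [lt_div_iff₀' hb, pow_mul_ofDigits]
  constructor
  · intro h
    exact_mod_cast (le_add_of_nonneg_right hnn).trans_lt h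
  · intro h
    have : (digitVal u m : ℝ) + 1 ≤ G := by exact_mod_cast h
    linarith

/-- Every finite digit string of length `m` occurs in the grid `E_m`. -/
theorem exists_mem_digitGrid {b : ℕ} [NeZero b] (hb : 1 < b) (m : ℕ) (v : ℕ → Fin b)
    (hv : ∀ j, m ≤ j → v j = 0) :
    ∃ w ∈ digitGrid b m, Real.digits w b = v := by
  have hnot : ∀ J, ∃ j, J ≤ j ∧ (v j : ℕ) + 1 ≠ b := fun J =>
    ⟨max J m, le_max_left _ _, by rw [hv _ (le_max_right _ _), Fin.val_zero]; omega⟩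
  obtain ⟨j, -, hj⟩ := hnot 0
  refine ⟨Real.ofDigits v, ⟨Real.ofDigits v, Real.ofDigits_nonneg v, ofDigits_lt_one hj, ?_⟩,
    digits_ofDigits hnot⟩
  rw [digitTrunc, digits_ofDigits hnot, Real.ofDigits_eq_sum_add_ofDigits v m]
  have h0 : Real.ofDigits (fun i => v (i + m)) = 0 := by
    simp [Real.ofDigits, Real.ofDigitsTerm, hv]
  rw [h0, mul_zero, add_zero]
  rfl

/-! ### Counting points in boxes -/

/-- The indices `n < M` for which, in every coordinate `i`, the digits of `z n i` before position
`j i` are those of `g i` and the digit at position `j i` is below that of `g i`. -/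
def boxIndices {ι : Type*} [Fintype ι] {b : ℕ} (M : ℕ) (z : ℕ → ι → ℕ → Fin b) (g : ι → ℕ → Fin b)
    (j : ι → ℕ) : Finset ℕ :=
  (range M).filter fun n => ∀ i, (∀ k < j i, z n i k = g i k) ∧ z n i (j i) < g i (j i)

theorem mem_boxIndices {ι : Type*} [Fintype ι] {b M : ℕ} {z : ℕ → ι → ℕ → Fin b}
    {g : ι → ℕ → Fin b} {j : ι → ℕ} {n : ℕ} : n ∈ boxIndices M z g j ↔
      n < M ∧ ∀ i, (∀ k < j i, z n i k = g i k) ∧ z n i (j i) < g i (j i) := by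
  rw [boxIndices, mem_filter, mem_range]

theorem card_prefix_box {b : ℕ} (g : ℕ → Fin b) {L j : ℕ} (hj : j < L) :
    (Fintype.piFinset fun k : Fin L =>
      if (k : ℕ) < j then {g k} else if (k : ℕ) = j then Iio (g j) else univ).card =
      (g j : ℕ) * b ^ (L - (j + 1)) := by
  rw [Fintype.card_piFinset]
  have h : ∀ k : Fin L, (if (k : ℕ) < j then {g k} else
      if (k : ℕ) = j then Iio (g j) else (univ : Finset (Fin b))).card =
      (fun k : ℕ => if k < j then 1 else if k = j then (g j : ℕ) else b) k := by
    intro k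
    split_ifs <;> simp_all
  rw [prod_congr rfl fun k _ => h k,
    Fin.prod_univ_eq_prod_range (fun k : ℕ => if k < j then 1 else if k = j then (g j : ℕ) else b)]
  obtain ⟨r, rfl⟩ := Nat.exists_eq_add_of_lt hj
  rw [show j + r + 1 = (j + 1) + r by omega, prod_range_add, prod_range_succ,
    prod_eq_one fun k hk => by rw [if_pos (mem_range.1 hk)]]
  have h2 : ∀ k ∈ range r, (if j + 1 + k < j then 1 else
      if j + 1 + k = j then (g j : ℕ) else b) = b := fun k _ => by
    rw [if_neg (by omega), if_neg (by omega)]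
  rw [prod_congr rfl h2]
  simp

/-- If the points are determined by their leading `L i` digits, where `∑ L i = m`, then a box cut
out by these digits contains the number of points that its volume predicts. -/
theorem card_boxIndices {ι : Type*} [Fintype ι] [DecidableEq ι] {b m : ℕ} (L : ι → ℕ)
    (hL : ∑ i, L i = m) (z : ℕ → ι → ℕ → Fin b)
    (hinj : ∀ n < b ^ m, ∀ n' < b ^ m, (∀ i, ∀ k < L i, z n i k = z n' i k) → n = n')
    (g : ι → ℕ → Fin b) (j : ι → ℕ) (hj : ∀ i, j i < L i) :
    (boxIndices (b ^ m) z g j).card = ∏ i, ((g i (j i) : ℕ) * b ^ (L i - (j i + 1))) := by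
  -- Both sides have `b ^ m` elements, so injectivity already shows that every digit pattern occurs
  -- exactly once.
  have hbij : Function.Bijective
      (fun (n : Fin (b ^ m)) (i : ι) (k : Fin (L i)) => z (n : ℕ) i (k : ℕ)) := by
    rw [Fintype.bijective_iff_injective_and_card]
    constructor
    · intro n n' h
      refine Fin.ext (hinj n n.2 n' n'.2 fun i k hk => ?_)
      exact congrFun (congrFun h i) ⟨k, hk⟩
    · simp [prod_pow_eq_pow_sum, hL]
  rw [← prod_congr rfl fun i _ => card_prefix_box (g i) (hj i), ← Fintype.card_piFinset]
  refine card_bij (fun n _ i (k : Fin (L i)) => z n i (k : ℕ)) ?_ ?_ ?_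
  · intro n hn
    rw [mem_boxIndices] at hn
    simp only [Fintype.mem_piFinset]
    intro i k
    split_ifs with h1 h2
    · exact mem_singleton.2 ((hn.2 i).1 k h1)
    · rw [mem_Iio, h2]
      exact (hn.2 i).2
    · exact mem_univ _
  · intro n hn n' hn' h
    exact hinj n (mem_boxIndices.1 hn).1 n' (mem_boxIndices.1 hn').1 fun i k hk =>
      congrFun (congrFun h i) ⟨k, hk⟩
  · intro D hD
    obtain ⟨n, hn⟩ := hbij.2 D
    refine ⟨n, mem_boxIndices.2 ⟨n.2, fun i => ?_⟩, hn⟩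
    have hD' := fun k => Fintype.mem_piFinset.1 (Fintype.mem_piFinset.1 hD i) k
    simp only [← hn] at hD'
    constructor
    · intro k hk
      have := hD' ⟨k, hk.trans (hj i)⟩
      rwa [if_pos hk, mem_singleton] at this
    · have := hD' ⟨j i, hj i⟩
      rwa [if_neg (lt_irrefl _), if_pos rfl, mem_Iio] at this

/-- The box `∏ [0, γ i)`, where `γ i` has the digits `g i`, is a disjoint union of boxes. -/
theorem card_filter_digitVal_lt {ι : Type*} [Fintype ι] [DecidableEq ι] {b : ℕ} (M m : ℕ)
    (z : ℕ → ι → ℕ → Fin b) (g : ι → ℕ → Fin b) :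
    ((range M).filter fun n => ∀ i, digitVal (z n i) m < digitVal (g i) m).card =
      ∑ j ∈ Fintype.piFinset fun _ : ι => range m, (boxIndices M z g j).card := by
  rw [← card_biUnion]
  · congr 1
    ext n
    simp only [mem_filter, mem_range, mem_biUnion, Fintype.mem_piFinset, mem_boxIndices,
      digitVal_lt_iff]
    constructor
    · rintro ⟨hn, h⟩
      choose j hj using h
      exact ⟨j, fun i => (hj i).1, hn, fun i => (hj i).2⟩
    · rintro ⟨j, hj, hn, h⟩
      exact ⟨hn, fun i => ⟨j i, hj i, h i⟩⟩
  · intro j _ j' _ hne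
    rw [Function.onFun, disjoint_left]
    intro n hn hn'
    obtain ⟨i, hi⟩ := Function.ne_iff.1 hne
    have h1 := (mem_boxIndices.1 hn).2 i
    have h2 := (mem_boxIndices.1 hn').2 i
    -- At the smaller of the two positions one box requires equality of digits and the other a
    -- strict inequality.
    rcases lt_or_gt_of_ne hi with h | h
    · exact h1.2.ne (h2.1 _ h)
    · exact h2.2.ne (h1.1 _ h)

theorem digitVal_div_pow {b : ℕ} [NeZero b] (u : ℕ → Fin b) (m : ℕ) :
    (digitVal u m : ℝ) / (b : ℝ) ^ m = ∑ k ∈ range m, (u k : ℝ) * ((b : ℝ) ^ (k + 1))⁻¹ := by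
  have hb : (b : ℝ) ≠ 0 := NeZero.ne _
  induction m with
  | zero => simp [digitVal]
  | succ m ih =>
    rw [sum_range_succ, ← ih, digitVal]
    push_cast
    field_simp
    ring

/-- The volume of a box minus the proportion of the points that lie in it. -/
def boxDefect {ι : Type*} [Fintype ι] {b : ℕ} (m : ℕ) (z : ℕ → ι → ℕ → Fin b) (g : ι → ℕ → Fin b)
    (j : ι → ℕ) : ℝ :=
  (b : ℝ) ^ m * ∏ i, (((g i (j i) : ℕ) : ℝ) * ((b : ℝ) ^ (j i + 1))⁻¹) -
    (boxIndices (b ^ m) z g j).card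

theorem volume_sub_card {ι : Type*} [Fintype ι] [DecidableEq ι] {b : ℕ} [NeZero b] (m : ℕ)
    (z : ℕ → ι → ℕ → Fin b) (g : ι → ℕ → Fin b) :
    (b : ℝ) ^ m * ∏ i, (digitVal (g i) m : ℝ) / (b : ℝ) ^ m -
      ((range (b ^ m)).filter fun n => ∀ i, digitVal (z n i) m < digitVal (g i) m).card =
      ∑ j ∈ Fintype.piFinset fun _ : ι => range m, boxDefect m z g j := by
  simp only [card_filter_digitVal_lt, digitVal_div_pow, prod_univ_sum, boxDefect, mul_sum,
    sum_sub_distrib, Nat.cast_sum]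

/-! ### Large boxes are fair, small boxes are empty -/

/-- Rounding `j i + 1` up to a multiple of `e i` costs at most `e i - 1`, in total at most `t`. What
is then missing to `m` is absorbed by the coordinate `i₀`, whose blocks have length one. -/
theorem exists_block_lengths {ι : Type*} [Fintype ι] [DecidableEq ι] {e : ι → ℕ} {t m : ℕ}
    (he : ∀ i, 1 ≤ e i) (ht : ∑ i, e i = t + Fintype.card ι) {i₀ : ι} (hi₀ : e i₀ = 1)
    (j : ι → ℕ) (hj : ∑ i, (j i + 1) + t ≤ m) :
    ∃ q : ι → ℕ, ∑ i, q i * e i = m ∧ ∀ i, j i < q i * e i := by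
  have h1 : ∀ i, j i < (j i / e i + 1) * e i := fun i => by
    rw [mul_comm]
    exact Nat.lt_mul_div_succ _ (he i)
  have h2 : ∑ i, (j i / e i + 1) * e i ≤ m := by
    refine le_trans ?_ hj
    have : ∑ i, ((j i / e i + 1) * e i + 1) ≤ ∑ i, ((j i + 1) + e i) := by
      refine sum_le_sum fun i _ => ?_
      have := Nat.div_mul_le_self (j i) (e i)
      rw [add_mul]
      omega
    rw [sum_add_distrib, sum_add_distrib (g := e), ht] at this
    simp only [sum_const, card_univ, smul_eq_mul, mul_one] at this
    omega
  refine ⟨fun i => (j i / e i + 1) + if i = i₀ then m - ∑ i, (j i / e i + 1) * e i else 0, ?_, ?_⟩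
  · simp only [add_mul _ (ite _ _ _), sum_add_distrib, ite_mul, zero_mul, sum_ite_eq', mem_univ,
      if_true, hi₀, mul_one]
    omega
  · intro i
    exact (h1 i).trans_le (Nat.mul_le_mul_right _ (Nat.le_add_right _ _))

/-- Rounding down to full blocks loses at most `e i - 1` per coordinate, in total at most `t`. -/
theorem le_sum_div_mul {ι : Type*} [Fintype ι] {e : ι → ℕ} {t m : ℕ}
    (he : ∀ i, 1 ≤ e i) (ht : ∑ i, e i = t + Fintype.card ι)
    (j : ι → ℕ) (hj : m + t ≤ ∑ i, j i) : m ≤ ∑ i, j i / e i * e i := by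
  have : ∑ i, (j i + 1) ≤ ∑ i, (j i / e i * e i + e i) := by
    refine sum_le_sum fun i _ => ?_
    have := Nat.lt_div_mul_add (a := j i) (he i)
    omega
  rw [sum_add_distrib, sum_add_distrib (g := e), ht] at this
  simp only [sum_const, card_univ, smul_eq_mul, mul_one] at this
  omega

/-- The box is cut out by full blocks of total length exactly `m`, and each pattern of such digits
belongs to one point. -/
theorem boxDefect_eq_zero {ι : Type*} [Fintype ι] [DecidableEq ι] {b : ℕ} [NeZero b]
    {e : ι → ℕ} {t m : ℕ} (he : ∀ i, 1 ≤ e i) (ht : ∑ i, e i = t + Fintype.card ι)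
    {i₀ : ι} (hi₀ : e i₀ = 1) {z : ℕ → ι → ℕ → Fin b}
    (hinj : ∀ q : ι → ℕ, m ≤ ∑ i, q i * e i → ∀ n < b ^ m, ∀ n' < b ^ m,
      (∀ i, ∀ k < q i * e i, z n i k = z n' i k) → n = n')
    (g : ι → ℕ → Fin b) (j : ι → ℕ) (hj : ∑ i, (j i + 1) + t ≤ m) :
    boxDefect m z g j = 0 := by
  obtain ⟨q, hq, hjq⟩ := exists_block_lengths he ht hi₀ j hj
  have hb : (b : ℝ) ≠ 0 := NeZero.ne _
  rw [boxDefect, card_boxIndices (fun i => q i * e i) hq z (hinj q hq.ge) g j hjq, ← hq,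
    ← prod_pow_eq_pow_sum, ← prod_mul_distrib, Nat.cast_prod, sub_eq_zero]
  refine prod_congr rfl fun i _ => ?_
  have h : (b : ℝ) ^ (q i * e i) = b ^ (q i * e i - (j i + 1)) * b ^ (j i + 1) := by
    rw [← pow_add, Nat.sub_add_cancel (hjq i)]
  rw [h]
  push_cast
  field_simp

/-- A point of the box shares its first `j i` digits with the point `n₀`; full blocks among these
total at least `m`, so its index is `n₀`. But the digit of `n₀` at position `j i` equals that of `g
i` and is not below it. -/
theorem boxIndices_eq_empty {ι : Type*} [Fintype ι] {b : ℕ}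
    {e : ι → ℕ} {t m : ℕ} (he : ∀ i, 1 ≤ e i) (ht : ∑ i, e i = t + Fintype.card ι) (i₀ : ι)
    {z : ℕ → ι → ℕ → Fin b}
    (hinj : ∀ q : ι → ℕ, m ≤ ∑ i, q i * e i → ∀ n < b ^ m, ∀ n' < b ^ m,
      (∀ i, ∀ k < q i * e i, z n i k = z n' i k) → n = n')
    {g : ι → ℕ → Fin b} {n₀ : ℕ} (hn₀ : n₀ < b ^ m) (hz : ∀ i, ∀ k < m, z n₀ i k = g i k)
    (j : ι → ℕ) (hjm : ∀ i, j i < m) (hj : m + t ≤ ∑ i, j i) :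
    boxIndices (b ^ m) z g j = ∅ := by
  rw [eq_empty_iff_forall_notMem]
  intro n hn
  rw [mem_boxIndices] at hn
  have h : n = n₀ := by
    refine hinj (fun i => j i / e i) (le_sum_div_mul he ht j hj) n hn.1 n₀ hn₀ fun i k hk => ?_
    have hkj : k < j i := hk.trans_le (Nat.div_mul_le_self _ _)
    rw [(hn.2 i).1 k hkj, hz i k (hkj.trans (hjm i))]
  have := (hn.2 i₀).2
  rw [h, hz i₀ _ (hjm i₀)] at this
  exact lt_irrefl _ this

/-- If the point `n₀` sits at the corner `γ` of the box `∏ [0, γ i)` and the boxes in the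
decomposition of this box are either large or small, then the large ones contain as many points as
expected and the small ones contain none. -/
theorem le_volume_sub_card {ι : Type*} [Fintype ι] [DecidableEq ι] {b : ℕ} [NeZero b]
    {e : ι → ℕ} {t m : ℕ} (he : ∀ i, 1 ≤ e i) (ht : ∑ i, e i = t + Fintype.card ι)
    {i₀ : ι} (hi₀ : e i₀ = 1) {z : ℕ → ι → ℕ → Fin b}
    (hinj : ∀ q : ι → ℕ, m ≤ ∑ i, q i * e i → ∀ n < b ^ m, ∀ n' < b ^ m,
      (∀ i, ∀ k < q i * e i, z n i k = z n' i k) → n = n')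
    {g : ι → ℕ → Fin b} {n₀ : ℕ} (hn₀ : n₀ < b ^ m) (hz : ∀ i, ∀ k < m, z n₀ i k = g i k)
    (hgap : ∀ j : ι → ℕ, (∀ i, j i < m) → (∀ i, g i (j i) ≠ 0) →
      ∑ i, (j i + 1) + t ≤ m ∨ m + t ≤ ∑ i, j i)
    (S : Finset (ι → ℕ)) (hS : ∀ j ∈ S, ∀ i, j i < m ∧ (g i (j i) : ℕ) + 1 = b)
    (hSsum : ∀ j ∈ S, ∑ i, (j i + 1) = m + (t + Fintype.card ι)) :
    (S.card : ℝ) * (((b : ℝ) - 1) ^ Fintype.card ι * ((b : ℝ) ^ (t + Fintype.card ι))⁻¹) ≤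
      (b : ℝ) ^ m * ∏ i, (digitVal (g i) m : ℝ) / (b : ℝ) ^ m -
        ((range (b ^ m)).filter fun n => ∀ i, digitVal (z n i) m < digitVal (g i) m).card := by
  have hb : (b : ℝ) ≠ 0 := NeZero.ne _
  rw [volume_sub_card]
  have hnonneg : ∀ j ∈ Fintype.piFinset fun _ : ι => range m, 0 ≤ boxDefect m z g j := by
    intro j hj
    have hjm : ∀ i, j i < m := fun i => mem_range.1 (Fintype.mem_piFinset.1 hj i)
    by_cases h0 : ∀ i, g i (j i) ≠ 0
    · rcases hgap j hjm h0 with h | h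
      · rw [boxDefect_eq_zero he ht hi₀ hinj g j h]
      · rw [boxDefect, boxIndices_eq_empty he ht i₀ hinj hn₀ hz j hjm h, card_empty, Nat.cast_zero,
          sub_zero]
        positivity
    · push Not at h0
      obtain ⟨i, hi⟩ := h0
      have h : boxIndices (b ^ m) z g j = ∅ := by
        rw [eq_empty_iff_forall_notMem]
        intro n hn
        have := ((mem_boxIndices.1 hn).2 i).2
        rw [hi] at this
        exact absurd this (Fin.not_lt_zero _)
      rw [boxDefect, h, card_empty, Nat.cast_zero, sub_zero]
      positivity
  have hsub : S ⊆ Fintype.piFinset fun _ : ι => range m := fun j hj =>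
    Fintype.mem_piFinset.2 fun i => mem_range.2 (hS j hj i).1
  -- All defects are nonnegative, so those outside `S` may be dropped; those in `S` are full volumes
  -- of empty boxes.
  refine le_trans (le_of_eq ?_) (sum_le_sum_of_subset_of_nonneg hsub fun j hj _ => hnonneg j hj)
  rw [← nsmul_eq_mul]
  refine (sum_eq_card_nsmul fun j hj => ?_).symm
  have hjsum := hSsum j hj
  have hjsum' : m + t ≤ ∑ i, j i := by
    rw [sum_add_distrib] at hjsum
    simp only [sum_const, card_univ, smul_eq_mul, mul_one] at hjsum
    omega
  rw [boxDefect, boxIndices_eq_empty he ht i₀ hinj hn₀ hz j (fun i => (hS j hj i).1) hjsum',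
    card_empty, Nat.cast_zero, sub_zero, prod_mul_distrib, prod_inv_distrib, prod_pow_eq_pow_sum,
    hjsum, pow_add]
  have h1 : ∀ i, ((g i (j i) : ℕ) : ℝ) = (b : ℝ) - 1 := fun i => by
    have h : ((g i (j i) : ℕ) : ℝ) + 1 = b := by exact_mod_cast (hS j hj i).2
    linarith
  rw [prod_congr rfl fun i _ => h1 i, prod_const, card_univ]
  field_simp

/-! ### The net of a shifted Niederreiter sequence -/

/-- The digits of the points `(x_{n ⊕ Q} ⊕ w, n / b ^ m)`: the coordinate `none` carries the digits
of `n`, most significant first, and `v i` are the digits of the shift `w i`. -/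
def netDigits {F : Type*} [Field F] {b : ℕ} [NeZero b] {s : ℕ} (m Q : ℕ) (ψ : ℕ → Fin b ≃ F)
    (η : Fin s → ℕ → F ≃ Fin b) (C : Fin s → ℕ → ℕ → F) (v : Fin s → ℕ → Fin b) (n : ℕ) :
    Option (Fin s) → ℕ → Fin b
  | none => fun j => natDigit b n (m - 1 - j)
  | some i => fun j => digitalDigit b ψ (η i) (C i) (natDigitAdd b m n Q) j + v i j

/-- Needed because `∑ᶠ` takes the default value `0` on infinite support. -/
theorem finite_support_mul_digit {F : Type*} [Field F] {b : ℕ} [NeZero b] {ψ : ℕ → Fin b ≃ F}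
    {R : ℕ} (hψ : ∀ r, R ≤ r → ψ r 0 = 0) (c : ℕ → F) {n m : ℕ} (hn : n < b ^ m) :
    (Function.support fun r => c r * ψ r (natDigit b n r)).Finite := by
  refine (range (max R m)).finite_toSet.subset fun r hr => ?_
  rw [coe_range, Set.mem_Iio]
  by_contra! h
  apply hr
  change c r * ψ r (natDigit b n r) = 0
  rw [natDigit_eq_zero_of_le hn ((le_max_right _ _).trans h), hψ r ((le_max_left _ _).trans h),
    mul_zero]

/-- Equal digits mean equal sums, as `η j` is injective. The vector consists of differences of `ψ`
values, since `ψ r` need not be additive. -/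
theorem sum_mul_sub_eq_zero {F : Type*} [Field F] {b : ℕ} [NeZero b] {ψ : ℕ → Fin b ≃ F}
    {R : ℕ} (hψ : ∀ r, R ≤ r → ψ r 0 = 0) {η : ℕ → F ≃ Fin b} {C : ℕ → ℕ → F} {n n' m h j : ℕ}
    (hn : n < b ^ m) (hn' : n' < b ^ m)
    (hh : ∀ r, h ≤ r → natDigit b n r = natDigit b n' r)
    (heq : digitalDigit b ψ η C n j = digitalDigit b ψ η C n' j) :
    ∑ r ∈ range h, C j r * (ψ r (natDigit b n r) - ψ r (natDigit b n' r)) = 0 := by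
  have h1 := sub_eq_zero.2 ((η j).injective heq)
  rw [← finsum_sub_distrib (finite_support_mul_digit hψ (C j) hn)
    (finite_support_mul_digit hψ (C j) hn')] at h1
  simp only [← mul_sub] at h1
  rw [← h1]
  refine (finsum_eq_sum_of_support_subset _ fun r hr => ?_).symm
  rw [coe_range, Set.mem_Iio]
  by_contra! h2
  apply hr
  change C j r * (ψ r (natDigit b n r) - ψ r (natDigit b n' r)) = 0
  rw [hh r h2, sub_self, mul_zero]

/-- Points of the net that agree in sufficiently many blocks of leading digits are equal. -/
theorem eq_of_netDigits_eq {F : Type*} [Field F] {b : ℕ} [NeZero b] {s : ℕ} {p : Fin s → F[X]}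
    (hp : ∀ i, 1 ≤ (p i).natDegree) (hcop : ∀ i i', i ≠ i' → IsCoprime (p i) (p i'))
    {y : Fin s → ℕ → ℕ → F[X]}
    (hy : ∀ i l, 1 ≤ l →
      LinearIndependent F (fun k : Fin (p i).natDegree => y i l (k : ℕ) % p i))
    {ψ : ℕ → Fin b ≃ F} {R : ℕ} (hψ : ∀ r, R ≤ r → ψ r 0 = 0) (η : Fin s → ℕ → F ≃ Fin b)
    (v : Fin s → ℕ → Fin b) (m Q : ℕ) (q : Option (Fin s) → ℕ)
    (hq : m ≤ ∑ o, q o * o.elim 1 fun i => (p i).natDegree)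
    (n : ℕ) (hn : n < b ^ m) (n' : ℕ) (hn' : n' < b ^ m)
    (heq : ∀ o, ∀ k < q o * o.elim 1 fun i => (p i).natDegree,
      netDigits m Q ψ η (fun i => niederreiterEntry (p i) (y i)) v n o k =
        netDigits m Q ψ η (fun i => niederreiterEntry (p i) (y i)) v n' o k) : n = n' := by
  rw [Fintype.sum_option] at hq
  simp only [Option.elim_none, Option.elim_some, mul_one] at hq
  have hN := natDigitAdd_lt b m n Q
  have hN' := natDigitAdd_lt b m n' Q
  -- The first `q none` digits in the coordinate `none` are the most significant digits of the
  -- index, so only the columns below `m - q none` remain unknown.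
  have htop : ∀ r, m - q none ≤ r →
      natDigit b (natDigitAdd b m n Q) r = natDigit b (natDigitAdd b m n' Q) r := by
    intro r hr
    rcases lt_or_ge r m with hrm | hrm
    · have h := heq none (m - 1 - r) (by simp only [Option.elim_none, mul_one]; omega)
      simp only [netDigits, show m - 1 - (m - 1 - r) = r by omega] at h
      rw [natDigit_natDigitAdd b _ _ hrm, natDigit_natDigitAdd b _ _ hrm, h]
    · rw [natDigit_eq_zero_of_le hN hrm, natDigit_eq_zero_of_le hN' hrm]
  have hzero := eq_zero_of_niederreiter_rows hp hcop hy (fun i => q (some i)) (m - q none)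
    (by omega)
    (fun r => ψ r (natDigit b (natDigitAdd b m n Q) r) -
      ψ r (natDigit b (natDigitAdd b m n' Q) r))
    fun i j hj => sum_mul_sub_eq_zero hψ hN hN' htop (add_right_cancel (heq (some i) j hj))
  refine eq_of_natDigit_eq hn hn' fun r hr => ?_
  have h : natDigit b (natDigitAdd b m n Q) r = natDigit b (natDigitAdd b m n' Q) r := by
    rcases lt_or_ge r (m - q none) with h | h
    · exact (ψ r).injective (sub_eq_zero.1 (hzero r h))
    · exact htop r h
  rw [natDigit_natDigitAdd b _ _ hr, natDigit_natDigitAdd b _ _ hr] at h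
  exact add_right_cancel h

/-! ### The corner of the test box -/

/-- The digit `b - 1`. -/
def maxDigit (b : ℕ) [NeZero b] : Fin b := ⟨b - 1, Nat.sub_lt (NeZero.pos b) one_pos⟩

/-- Digits `b - 1` at the positions in a residue class modulo `G`, and `0` elsewhere; the class is
that of `0` for the coordinates `some i`, and that of `M` for `none`. -/
def cornerDigits (b : ℕ) [NeZero b] {s : ℕ} (G M : ℕ) : Option (Fin s) → ℕ → Fin b
  | none => fun j => if j + 1 ≡ M [MOD G] then maxDigit b else 0
  | some _ => fun j => if G ∣ j + 1 then maxDigit b else 0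

theorem digitVal_pos {b : ℕ} [NeZero b] {u : ℕ → Fin b} {m j : ℕ} (hj : j < m) (hu : u j ≠ 0) :
    0 < digitVal u m := by
  rw [digitVal_eq_sum]
  refine sum_pos' (fun _ _ => Nat.zero_le _) ⟨j, mem_range.2 hj, ?_⟩
  exact Nat.mul_pos (Nat.pos_of_ne_zero fun h => hu (Fin.ext h)) (pow_pos (NeZero.pos b) _)

theorem maxDigit_ne_zero {b : ℕ} [NeZero b] (hb : 1 < b) : maxDigit b ≠ 0 := by
  intro h
  have := congrArg Fin.val h
  simp only [maxDigit, Fin.val_zero] at this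
  omega

/-- The sizes of the boxes in the decomposition of the test box leave out the critical range. -/
theorem sum_add_le_or_le_sum {b : ℕ} [NeZero b] {s d t m : ℕ} (hd : d = t + s)
    (j : Option (Fin s) → ℕ)
    (hj : ∀ o, cornerDigits b (d + t + 1) (m + d + 1) o (j o) ≠ 0) :
    ∑ o, (j o + 1) + t ≤ m ∨ m + t ≤ ∑ o, j o := by
  have hnone : j none + 1 ≡ m + d + 1 [MOD d + t + 1] := by
    by_contra h
    exact hj none (if_neg h)
  have hsome : ∀ i, (d + t + 1) ∣ j (some i) + 1 := by
    intro i
    by_contra h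
    exact hj (some i) (if_neg h)
  have hT : ∑ o, (j o + 1) ≡ m + d + 1 [MOD d + t + 1] := by
    rw [Fintype.sum_option]
    exact hnone.add ((Nat.modEq_zero_iff_dvd).2 (dvd_sum fun i _ => hsome i))
  have hsum : ∑ o, (j o + 1) = ∑ o, j o + (s + 1) := by
    rw [sum_add_distrib]
    simp
  -- Below `m + d + 1` the congruence forces a drop by at least `d + t + 1`, to `m - t`. Otherwise
  -- `∑ j o ≥ m + d - s = m + t`.
  rcases lt_or_ge (∑ o, (j o + 1)) (m + d + 1) with h | h
  · have := Nat.le_of_dvd (by omega) ((Nat.modEq_iff_dvd' h.le).1 hT)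
    omega
  · omega

/-- Positions `G * (k i + 1)` in the coordinates `some i`, completed to total `M + 1`. -/
def completedPositions {s : ℕ} (G M : ℕ) (k : Fin s → ℕ) : Option (Fin s) → ℕ
  | none => M - ∑ i, G * (k i + 1)
  | some i => G * (k i + 1) - 1

/-- Many boxes in the decomposition of the test box have the largest subcritical volume. -/
theorem exists_critical_positions {b : ℕ} [NeZero b] {s d t m : ℕ} (hs : 1 ≤ s) :
    ∃ S : Finset (Option (Fin s) → ℕ), S.card = (m / ((d + t + 1) * s)) ^ s ∧
      (∀ j ∈ S, ∀ o, j o < m ∧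
        ((cornerDigits b (d + t + 1) (m + d + 1) o (j o) : Fin b) : ℕ) + 1 = b) ∧
      ∀ j ∈ S, ∑ o, (j o + 1) = m + (d + 1) := by
  set G := d + t + 1 with hG
  set R := m / (G * s) with hR
  have hmax : ((maxDigit b : Fin b) : ℕ) + 1 = b := Nat.sub_add_cancel (NeZero.pos b)
  have hGR : G * R * s ≤ m := by
    calc G * R * s = m / (G * s) * (G * s) := by rw [← hR]; ring
      _ ≤ m := Nat.div_mul_le_self _ _
  have hkG : ∀ k ∈ Fintype.piFinset fun _ : Fin s => range R, ∀ i, G ≤ G * (k i + 1) ∧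
      G * (k i + 1) ≤ G * R := fun k hk i =>
    ⟨Nat.le_mul_of_pos_right _ (Nat.succ_pos _),
      Nat.mul_le_mul_left _ (mem_range.1 (Fintype.mem_piFinset.1 hk i))⟩
  have hsumle : ∀ k ∈ Fintype.piFinset fun _ : Fin s => range R, ∑ i, G * (k i + 1) ≤ m :=
    fun k hk => by
      refine (sum_le_card_nsmul _ _ _ fun i _ => (hkG k hk i).2).trans ?_
      rwa [card_univ, Fintype.card_fin, smul_eq_mul, mul_comm]
  -- This lower bound puts the completing position `m + d - ∑ G * (k i + 1)` below `m`.
  have hlesum : ∀ k ∈ Fintype.piFinset fun _ : Fin s => range R, G ≤ ∑ i, G * (k i + 1) :=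
    fun k hk => ((hkG k hk ⟨0, hs⟩).1).trans
      (single_le_sum (f := fun i => G * (k i + 1)) (fun _ _ => Nat.zero_le _) (mem_univ _))
  refine ⟨(Fintype.piFinset fun _ : Fin s => range R).image (completedPositions G (m + d)),
    ?_, ?_, ?_⟩
  · rw [card_image_of_injOn, Fintype.card_piFinset]
    · simp
    · intro k hk k' hk' h
      funext i
      have h1 := congrFun h (some i)
      simp only [completedPositions] at h1
      have h2 := (hkG k hk i).1
      have h3 := (hkG k' hk' i).1
      have h4 : G * (k i + 1) = G * (k' i + 1) := by omega
      have h5 := Nat.eq_of_mul_eq_mul_left (by omega) h4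
      omega
  · intro j hj o
    obtain ⟨k, hk, rfl⟩ := mem_image.1 hj
    have h1 := hsumle k hk
    have h2 := hlesum k hk
    match o with
    | none =>
      refine ⟨by simp only [completedPositions]; omega, ?_⟩
      dsimp only [cornerDigits]
      rw [if_pos, hmax]
      refine (Nat.modEq_iff_dvd' (by simp only [completedPositions]; omega)).2 ?_
      rw [show m + d + 1 - (completedPositions G (m + d) k none + 1) = ∑ i, G * (k i + 1) by
        simp only [completedPositions]; omega]
      exact dvd_sum fun i _ => dvd_mul_right _ _
    | some i =>
      have h3 := hkG k hk i
      have h4 : G * R ≤ m := (Nat.le_mul_of_pos_right _ hs).trans hGR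
      refine ⟨by simp only [completedPositions]; omega, ?_⟩
      dsimp only [cornerDigits]
      rw [if_pos, hmax]
      rw [completedPositions, Nat.sub_add_cancel (by omega)]
      exact dvd_mul_right _ _
  · intro j hj
    obtain ⟨k, hk, rfl⟩ := mem_image.1 hj
    have h1 := hsumle k hk
    rw [Fintype.sum_option, sum_congr rfl fun i _ => show
      completedPositions G (m + d) k (some i) + 1 = G * (k i + 1) by
        have := (hkG k hk i).1
        simp only [completedPositions]
        omega]
    simp only [completedPositions]
    omega

/-! ### The star discrepancy -/

/-- The bound `1` on the normalized discrepancies is what makes the supremum meaningful: `sSup` of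
an unbounded set of reals is `0`. -/
theorem abs_localDiscrepancy_le {s : ℕ} (x : ℕ → Fin s → ℝ) {N : ℕ} (hN : 1 ≤ N) {γ : Fin s → ℝ}
    (hγ : ∀ i, 0 < γ i ∧ γ i ≤ 1) :
    |localDiscrepancy x N γ| ≤ N * starDiscrepancy x N := by
  classical
  have hN' : (0 : ℝ) < N := by exact_mod_cast hN
  rw [mul_comm, ← div_le_iff₀ hN', starDiscrepancy]
  refine le_csSup ⟨1, ?_⟩ ⟨γ, hγ, rfl⟩
  rintro _ ⟨δ, hδ, rfl⟩
  rw [div_le_one hN', localDiscrepancy]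
  have h1 := card_filter_le (range N) fun n => ∀ i, x n i ∈ Set.Ico 0 (δ i)
  rw [card_range] at h1
  have h2 : (((range N).filter fun n => ∀ i, x n i ∈ Set.Ico 0 (δ i)).card : ℝ) ≤ N := by
    exact_mod_cast h1
  have h3 : (0 : ℝ) ≤ ((range N).filter fun n => ∀ i, x n i ∈ Set.Ico 0 (δ i)).card :=
    Nat.cast_nonneg _
  have h4 : ∏ i, δ i ≤ 1 := prod_le_one (fun i _ => (hδ i).1.le) fun i _ => (hδ i).2
  have h5 : 0 ≤ ∏ i, δ i := prod_nonneg fun i _ => (hδ i).1.le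
  rw [abs_le]
  constructor <;> nlinarith

/-- With `u = d + t` and `R = ⌊m / ((u + 1) s)⌋`, one has `m < (R + 1) (u + 1) s ≤ (R + 1) 2 u s`.
For `s ≥ 2` this and the size of `m` give `m / (4 u s²) ≤ R / 2`; the summand `1` on the right is
used only for `s = 1`. The factor `(b - 1) ^ (s + 1) / b` is at least `1 / 2`. -/
theorem bound_le {b s d t m : ℕ} (hb : 2 ≤ b) (hs : 1 ≤ s) (hd : 1 ≤ d)
    (hm : 9 * (d + t) * s ^ 2 ≤ m) :
    ((b : ℝ) ^ d)⁻¹ * (boundK d t (s + 1) ^ s)⁻¹ * (m : ℝ) ^ s ≤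
      1 + (((m / ((d + t + 1) * s)) ^ s : ℕ) : ℝ) *
        (((b : ℝ) - 1) ^ (s + 1) * ((b : ℝ) ^ (d + 1))⁻¹) := by
  set u := d + t with hu
  set R := m / ((u + 1) * s) with hR
  have hb' : (2 : ℝ) ≤ b := by exact_mod_cast hb
  have hbd : (0 : ℝ) < (b : ℝ) ^ d := by positivity
  have hu1 : (1 : ℝ) ≤ u := by exact_mod_cast (by omega : 1 ≤ u)
  have hs1 : (1 : ℝ) ≤ s := by exact_mod_cast hs
  have hK : boundK d t (s + 1) = 4 * u * s ^ 2 := by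
    rw [boundK, hu]
    push_cast
    ring
  have hKpos : (0 : ℝ) < 4 * u * s ^ 2 := by positivity
  have hfrac : (1 : ℝ) / 2 ≤ ((b : ℝ) - 1) ^ (s + 1) * (b : ℝ)⁻¹ := by
    have h1 : (b : ℝ) - 1 ≤ ((b : ℝ) - 1) ^ (s + 1) := le_self_pow₀ (by linarith) (by omega)
    rw [← div_eq_mul_inv, le_div_iff₀ (by linarith)]
    linarith
  have hmR : m < (R + 1) * ((u + 1) * s) := by
    have := Nat.lt_div_mul_add (a := m) (b := (u + 1) * s) (by positivity)
    rw [add_mul, one_mul]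
    exact this
  have hmR' : (m : ℝ) < (R + 1) * ((u + 1) * s) := by exact_mod_cast hmR
  have hm' : (9 : ℝ) * u * s ^ 2 ≤ m := by exact_mod_cast hm
  have key : ((m : ℝ) / (4 * u * s ^ 2)) ^ s ≤ (b : ℝ) ^ d + (R : ℝ) ^ s * (1 / 2) := by
    rcases Nat.lt_or_ge s 2 with h2 | h2
    · obtain rfl : s = 1 := by omega
      have hbd2 : (2 : ℝ) ≤ (b : ℝ) ^ d := hb'.trans (le_self_pow₀ (by linarith) (by omega))
      simp only [Nat.cast_one, one_pow, mul_one, pow_one] at *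
      rw [div_le_iff₀ (by positivity)]
      nlinarith [Nat.cast_nonneg (α := ℝ) R]
    · have hs2 : (2 : ℝ) ≤ s := by exact_mod_cast h2
      have hR0 : (0 : ℝ) ≤ R := Nat.cast_nonneg R
      have h3 : (m : ℝ) / (4 * u * s ^ 2) ≤ R / 2 := by
        rw [div_le_iff₀ hKpos]
        have h4 : (m : ℝ) ≤ (R + 1) * (2 * u * s) := by
          refine hmR'.le.trans ?_
          gcongr
          linarith
        have h5 : (s : ℝ) * m ≤ (R + 1) * (2 * u * s) * s := by nlinarith
        have h6 : (2 : ℝ) * m ≤ s * m := by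
          have : (0 : ℝ) ≤ m := Nat.cast_nonneg m
          nlinarith
        nlinarith
      calc ((m : ℝ) / (4 * u * s ^ 2)) ^ s ≤ (R / 2) ^ s := by gcongr
        _ = R ^ s * (1 / 2) ^ s := by rw [← mul_pow]; ring
        _ ≤ R ^ s * (1 / 2) := by
          gcongr
          exact pow_le_of_le_one (by norm_num) (by norm_num) (by omega)
        _ ≤ _ := le_add_of_nonneg_left hbd.le
  rw [hK]
  push_cast
  calc ((b : ℝ) ^ d)⁻¹ * ((4 * (u : ℝ) * s ^ 2) ^ s)⁻¹ * (m : ℝ) ^ s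
      = ((b : ℝ) ^ d)⁻¹ * ((m : ℝ) / (4 * u * s ^ 2)) ^ s := by
        rw [div_pow]
        ring
    _ ≤ ((b : ℝ) ^ d)⁻¹ * ((b : ℝ) ^ d + (R : ℝ) ^ s * (1 / 2)) := by gcongr
    _ ≤ ((b : ℝ) ^ d)⁻¹ * ((b : ℝ) ^ d + (R : ℝ) ^ s * (((b : ℝ) - 1) ^ (s + 1) * (b : ℝ)⁻¹)) := by
        gcongr
    _ = _ := by
        rw [mul_add, inv_mul_cancel₀ hbd.ne', pow_succ (b : ℝ) d, mul_inv]
        ring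

/-- A box that contains too few of the points `(x_{n ⊕ Q} ⊕ w, n / b ^ m)`, where `N / b ^ m` is its
side length in the last coordinate, bounds the discrepancy of the first `N` points from below. -/
theorem le_mul_starDiscrepancy_of_le_volume_sub_card {b : ℕ} [NeZero b] {s m N : ℕ} {B : ℝ}
    {z : ℕ → Option (Fin s) → ℕ → Fin b} {g : Option (Fin s) → ℕ → Fin b} {X : ℕ → Fin s → ℝ}
    (hz : ∀ n, z n none = fun j => natDigit b n (m - 1 - j))
    (hX : ∀ n i, X n i = Real.ofDigits (z n (some i)))
    (hreg : ∀ n i J, ∃ j, J ≤ j ∧ ((z n (some i) j : Fin b) : ℕ) + 1 ≠ b)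
    (hN : N = digitVal (g none) m) (hN1 : 1 ≤ N) (hpos : ∀ i, 0 < digitVal (g (some i)) m)
    (hB : B ≤ (b : ℝ) ^ m * ∏ o, (digitVal (g o) m : ℝ) / (b : ℝ) ^ m -
      ((range (b ^ m)).filter fun n => ∀ o, digitVal (z n o) m < digitVal (g o) m).card) :
    B ≤ N * starDiscrepancy X N := by
  classical
  have hbm : (0 : ℝ) < (b : ℝ) ^ m := pow_pos (Nat.cast_pos.2 (NeZero.pos b)) _
  set γ : Fin s → ℝ := fun i => (digitVal (g (some i)) m : ℝ) / (b : ℝ) ^ m with hγ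
  have hγ01 : ∀ i, 0 < γ i ∧ γ i ≤ 1 := fun i =>
    ⟨div_pos (Nat.cast_pos.2 (hpos i)) hbm,
      (div_le_one hbm).2 (by exact_mod_cast (digitVal_lt_pow (g (some i)) m).le)⟩
  refine le_trans ?_ (abs_localDiscrepancy_le X hN1 hγ01)
  -- The deficit is minus the local discrepancy: the condition in the coordinate `none` reads `n <
  -- N`, and its side length `N / b ^ m` turns the factor `b ^ m` into `N`.
  refine le_trans (hB.trans (le_of_eq ?_)) (neg_le_abs _)
  have hfilter : ((range (b ^ m)).filter fun n => ∀ o, digitVal (z n o) m < digitVal (g o) m) =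
      (range N).filter fun n => ∀ i, X n i ∈ Set.Ico 0 (γ i) := by
    ext n
    simp only [mem_filter, mem_range, Option.forall, Set.mem_Ico, hX, hγ,
      ofDigits_lt_div_iff (hreg n _), Real.ofDigits_nonneg, true_and]
    constructor
    · rintro ⟨h1, h2, h3⟩
      rw [hz, digitVal_natDigit h1, ← hN] at h2
      exact ⟨h2, h3⟩
    · rintro ⟨h1, h2⟩
      have h3 : n < b ^ m := h1.trans (hN ▸ digitVal_lt_pow _ _)
      refine ⟨h3, ?_, h2⟩
      rwa [hz, digitVal_natDigit h3, ← hN]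
  rw [localDiscrepancy, hfilter, Fintype.prod_option, ← hN]
  field_simp
  ring

end

/-! ### The lower bound for the shifted sequence -/

theorem theorem3 {F : Type*} [Field F] [Fintype F] (b : ℕ) [NeZero b] (hb : Fintype.card F = b)
    (s : ℕ) (hs : 1 ≤ s) (p : Fin s → F[X]) (x : ℕ → Fin s → ℝ)
    (hx : IsGeneralizedNiederreiter b p x)
    (e₀ d t : ℕ) (he₀ : e₀ = ∑ i, (p i).natDegree) (hd : d = e₀) (ht : t + s = e₀)
    (m : ℕ) (hm : 9 * (d + t) * s ^ 2 ≤ m) :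
    ∀ Q : ℕ, Q < b ^ m →
      ∃ N : ℕ, 1 ≤ N ∧ N ≤ b ^ m ∧
        ∃ w : Fin s → ℝ, (∀ i, w i ∈ digitGrid b m) ∧
          ((b : ℝ) ^ d)⁻¹ * (boundK d t (s + 1) ^ s)⁻¹ * (m : ℝ) ^ s ≤
            1 + (N : ℝ) *
              starDiscrepancy (fun n => digitalShift b (x (natDigitAdd b m n Q)) w) N := by
  obtain ⟨hp, hcop, y, ψ, η, hy, ⟨R, hψ⟩, hreg, hxdig⟩ := hx
  have hb2 : 1 < b := hb ▸ Fintype.one_lt_card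
  have hse : s ≤ e₀ := by
    have := card_nsmul_le_sum univ (fun i => (p i).natDegree) 1 fun i _ => hp i
    rw [he₀]
    simpa using this
  have hd1 : 1 ≤ d := by omega
  have hmu : d + t + 1 ≤ m := by
    have : 1 ≤ s ^ 2 := Nat.one_le_pow _ _ hs
    nlinarith
  intro Q _
  set C : Fin s → ℕ → ℕ → F := fun i => niederreiterEntry (p i) (y i) with hC
  set g : Option (Fin s) → ℕ → Fin b := cornerDigits b (d + t + 1) (m + d + 1) with hg
  have hNpos : 0 < digitVal (g none) m := by
    -- Here `j + 1 = m - t`, the largest number below `m + d + 1` in its residue class.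
    refine digitVal_pos (j := m + d - (d + t + 1)) (by omega) ?_
    rw [hg]
    dsimp only [cornerDigits]
    rw [if_pos]
    · exact maxDigit_ne_zero hb2
    · rw [Nat.modEq_iff_dvd' (by omega)]
      exact dvd_of_eq (by omega)
  have hgpos : ∀ i, 0 < digitVal (g (some i)) m := by
    intro i
    refine digitVal_pos (j := d + t) (by omega) ?_
    rw [hg]
    dsimp only [cornerDigits]
    rw [if_pos dvd_rfl]
    exact maxDigit_ne_zero hb2
  have hNlt := digitVal_lt_pow (g none) m
  -- `N` is both the number of points and the index of the point placed at the corner, whose last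
  -- coordinate `N / b ^ m` is right automatically.
  set N := digitVal (g none) m with hN
  -- The first `m` digits carry the point of index `N` to the corner; the zeros beyond keep `w` in
  -- `E_m` and leave the tails of all points unchanged.
  set v : Fin s → ℕ → Fin b := fun i j =>
    if j < m then g (some i) j - digitalDigit b ψ (η i) (C i) (natDigitAdd b m N Q) j else 0 with hv
  choose w hw hwv using fun i => exists_mem_digitGrid hb2 m (v i) fun j hj => if_neg hj.not_gt
  refine ⟨N, hNpos, hNlt.le, w, hw, ?_⟩
  obtain ⟨S, hScard, hSdig, hSsum⟩ := exists_critical_positions (b := b) (d := d) (t := t) (m := m) hs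
  have hcard : Fintype.card (Option (Fin s)) = s + 1 := by simp
  have htd : t + Fintype.card (Option (Fin s)) = d + 1 := by omega
  have hvol := le_volume_sub_card (e := fun o : Option (Fin s) => o.elim 1 fun i => (p i).natDegree)
    (t := t) (m := m) (i₀ := none) (z := netDigits m Q ψ η C v) (g := g) (n₀ := N)
    (Option.rec le_rfl hp)
    (by
      rw [Fintype.sum_option, htd, hd, he₀]
      simp only [Option.elim_none, Option.elim_some]
      omega)
    rfl (eq_of_netDigits_eq hp hcop hy hψ η v m Q) hNlt
    (by
      rintro (_ | i) k hk
      · exact natDigit_digitVal (g none) hk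
      · simp only [netDigits, hv, if_pos hk, add_sub_cancel])
    (fun j _ hj => sum_add_le_or_le_sum (by omega) j hj) S hSdig
    (fun j hj => by rw [htd]; exact hSsum j hj)
  rw [htd, hcard, hScard] at hvol
  refine (bound_le hb2 hs hd1 hm).trans (add_le_add_right ?_ 1)
  refine le_mul_starDiscrepancy_of_le_volume_sub_card (fun n => rfl) (fun n i => ?_)
    (fun n i J => ?_) rfl hNpos hgpos hvol
  · rw [digitalShift]
    congr 1
    funext j
    rw [hxdig, digits_ofDigits (hreg _ i), hwv i]
    rfl
  · obtain ⟨j, hj, hj'⟩ := hreg (natDigitAdd b m n Q) i (max J m)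
    refine ⟨j, (le_max_left _ _).trans hj, ?_⟩
    simp only [netDigits, hv, if_neg ((le_max_right _ _).trans hj).not_gt, add_zero]
    exact hj'
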